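/- **Theorem (Descartes' Theorem).** Let $S\subset\mathbb R^3$ be a smooth connected surface, i.e. a nonempty connected set which near each of its points is the zero set of a $C^1$ function with nowhere vanishing gradient (in particular, $S$ may be any $C^\infty$ connected surface). A *focus* $F$ is either a point of $\mathbb R^3$ not on $S$, or a point at infinity, given by a line through the origin spanned by a unit vector $e$; the *ray vector* of $F$ at $P\in S$ is $\overrightarrow{FP}$ in the first case and $e$ in the second. Call $S$ a *perfect lens* relative to $F$ and $F'$ if 1. at each $P\in S$ the normal to $S$ lies in the span of the two ray vectors at $P$, and 2. there is a constant $n\in\mathbb R$ such that at every $P\in S$ the angles $\theta_1,\theta_2$ which the ray vectors of $F$ and $F'$ form with the normal satisfy $\sin\theta_1=n\,\sin\theta_2$. Then: (a) *(Two finite foci.)* If $F\ne F'$ are points of $\mathbb R^3$ not on $S$, and $b=|FF'|$, then $S$ is a perfect lens relative to $F$ and $F'$ if and only if there are $n,c\in\mathbb R$ such that $S$ is contained in the ovoid obtained by revolving the cartesian oval $$\sqrt{x^2+y^2}+n\sqrt{(x-b)^2+y^2}=c$$ about its axis, where the $x$-axis is placed along the line $FF'$, with $F=(0,0)$ and $F'=(b,0)$.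 (The conic sections $n=\pm1$, and $n=0$, are allowed.) (b) *(First focus at infinity.)* If $F$ is the point at infinity in the direction of the unit vector $e$, and $F'\notin S$ is a point of $\mathbb R^3$, then $S$ is a perfect lens relative to $F$ and $F'$ if and only if there are $n,c\in\mathbb R$ such that $S$ is contained in the surface obtained by revolving the (proper or degenerate) conic $x+n\sqrt{x^2+y^2}=c$ about the $x$-axis, placed with its origin at $F'$ and in the direction $e$. (c) *(Second focus at infinity.)* If $F\notin S$ is a point of $\mathbb R^3$ and $F'$ is the point at infinity in the direction of the unit vector $e'$, then $S$ is a perfect lens relative to $F$ and $F'$ if and only if there are $n,c\in\mathbb R$ such that $S$ is contained in the surface obtained by revolving the (proper or degenerate) conic $\sqrt{x^2+y^2}+n\,x=c$ about the $x$-axis, placed with its origin at $F$ and in the direction $e'$. (d) *(Both foci at infinity.)* If $F$ and $F'$ are the points at infinity in the directions of the unit vectors $e$ and $e'$ (possibly parallel), then $S$ is a perfect lens relative to $F$ and $F'$ if and only if there are $n,c\in\mathbb R$ with $e+ne'\neq0$ such that $S$ is contained in the plane obtained by revolving the straight line $x=c$ about the $x$-axis, placed with its origin at the origin of $\mathbb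 R^3$ and in the direction of $e+ne'$. -/

import Mathlib

open scoped RealInnerProductSpace

noncomputable section

/-- Euclidean three-dimensional space. -/
abbrev Space : Type := EuclideanSpace ℝ (Fin 3)

/-- `g = 0` is a regular `C¹` equation of the set `S` in the open neighbourhood `U` of `P`. -/
structure IsLocalEquation (S : Set Space) (P : Space) (U : Set Space) (g : Space → ℝ) : Prop where
  isOpen : IsOpen U
  mem : P ∈ U
  contDiffOn : ContDiffOn ℝ 1 g U
  gradient_ne_zero : ∀ Q ∈ U, gradient g Q ≠ 0
  mem_iff : ∀ Q ∈ U, Q ∈ S ↔ g Q = 0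

/-- A smooth connected surface in space: a connected (in particular nonempty) set that near each
of its points is the zero set of a `C¹` function with nowhere vanishing gradient. -/
structure IsSmoothConnectedSurface (S : Set Space) : Prop where
  isConnected : IsConnected S
  exists_equation : ∀ P ∈ S, ∃ U g, IsLocalEquation S P U g

/-- `N` is a (nonzero) normal vector of `S` at `P`: the gradient at `P` of a regular local equation
of `S` near `P`. For a smooth surface it is determined up to a nonzero real factor, and all nonzero
multiples occur. -/
def IsNormalAt (S : Set Space) (P N : Space) : Prop :=
  ∃ U g, IsLocalEquation S P U g ∧ N = gradient g P

/-- A focus: a point of space, or the point at infinity of the line spanned by a vector `e`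
(used with `‖e‖ = 1`; the vectors `e` and `-e` stand for the same point at infinity). -/
inductive Focus : Type
  | point (F : Space) : Focus
  | infinity (e : Space) : Focus

/-- The direction of the line which joins a focus to `P`. -/
def Focus.ray : Focus → Space → Space
  | .point F, P => P - F
  | .infinity e, _ => e

/-- The perfect lens conditions: at each point `P` of `S` every normal vector lies in the span of
the two rays, and there is one constant `n` such that the sines of the angles which the two rays
form with the normal satisfy `sin θ₁ = n * sin θ₂` at every point of `S`. -/
def IsPerfectLens (S : Set Space) (F F' : Focus) : Prop :=
  (∀ P ∈ S, ∀ N, IsNormalAt S P N → N ∈ Submodule.span ℝ {F.ray P, F'.ray P}) ∧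
  ∃ n : ℝ, ∀ P ∈ S, ∀ N, IsNormalAt S P N →
    Real.sin (InnerProductGeometry.angle (F.ray P) N) =
      n * Real.sin (InnerProductGeometry.angle (F'.ray P) N)

/-- The cartesian oval `d₁ + n d₂ = c` in the plane, with foci `(0, 0)` and `(b, 0)`. -/
def cartesianOval (b n c : ℝ) : Set (ℝ × ℝ) :=
  {p | √(p.1 ^ 2 + p.2 ^ 2) + n * √((p.1 - b) ^ 2 + p.2 ^ 2) = c}

/-- The limiting curve `x + n d₂ = c`: first focus at infinity on the `x`-axis, second focus at
the origin. -/
def ovalFirstAtInfinity (n c : ℝ) : Set (ℝ × ℝ) :=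
  {p | p.1 + n * √(p.1 ^ 2 + p.2 ^ 2) = c}

/-- The limiting curve `d₁ + n x = c`: first focus at the origin, second focus at infinity on the
`x`-axis. -/
def ovalSecondAtInfinity (n c : ℝ) : Set (ℝ × ℝ) :=
  {p | √(p.1 ^ 2 + p.2 ^ 2) + n * p.1 = c}

/-- The unit vector in the direction of `v` (for `v ≠ 0`). -/
def unitDirection (v : Space) : Space := ‖v‖⁻¹ • v

/-- The set of points of space swept out by a plane set `C` when the plane is placed with its origin
at `A` and its `x`-axis along the unit vector `e`, and is revolved around this axis. -/
def revolve (A e : Space) (C : Set (ℝ × ℝ)) : Set Space :=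
  {P | ∃ p ∈ C, ∃ w : Space, ‖w‖ = 1 ∧ ⟪e, w⟫ = 0 ∧ P = A + p.1 • e + p.2 • w}

end

open Filter Metric Set Topology

/-! To each focus belongs a function whose gradient on `S` is the unit ray: the distance to a finite
focus, the height `⟪e, ·⟫` for a focus at infinity. Call them `φ`, `ψ`, with gradients `u`, `v`. If
`N = a u + b v` is normal and `u`, `v` are independent, the lengths of the components of `N`
orthogonal to `u` and `v` turn the sine law into `|b| = n |a|`. So `N` is parallel to `u + n v` or
to `u - n v`, the gradients of `φ ± n ψ`. If the sign were fixed, `φ ± n ψ` would have zero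
derivative along `S` and be constant, which is the equation of the oval.

The difficulty is the sign. Where `u`, `v` are independent and `n ≠ 0`, the two alternatives are
closed and exclude each other, so the sign is constant on connected pieces. Unless both foci are at
infinity in parallel directions, the points with `u`, `v` parallel lie on one line (the axis), and
at such a point the axis is normal to `S`. In a chart over the tangent plane it therefore meets `S`
only at the centre. A punctured disc is connected, so the sign is constant there and continuity
covers the centre (`IsRefracting.eventually_eq`). Connectedness of `S` then gives one sign and one
constant (`IsRefracting.exists_eq`).

Conversely, if `φ + m ψ` is constant on `S`, every normal is a multiple of `u + m v`, provided this
is nonzero, and the lens conditions hold with `n = |m|` (`isPerfectLens_of_eq`). Vanishing would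
require `m = ±1` and a degenerate oval contained in the axis, which contains no surface; with both
foci at infinity it is excluded by `e + n e' ≠ 0`. -/

theorem isConnected_ball_diff_singleton {E : Type*} [NormedAddCommGroup E]
    [InnerProductSpace ℝ E] (h : 1 < Module.rank ℝ E) (x : E) {r : ℝ} (hr : 0 < r) :
    IsConnected (ball x r \ {x}) := by
  have h1 := (isConnected_compl_singleton_of_one_lt_rank h (0 : E)).image
    (OpenPartialHomeomorph.univBall x r) (OpenPartialHomeomorph.continuous_univBall x r).continuousOn
  convert h1 using 1
  have hinj : InjOn (OpenPartialHomeomorph.univBall x r) univ := by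
    simpa using (OpenPartialHomeomorph.univBall x r).injOn
  have himg : OpenPartialHomeomorph.univBall x r '' univ = ball x r := by
    have := (OpenPartialHomeomorph.univBall x r).image_source_eq_target
    simpa [OpenPartialHomeomorph.univBall_target x hr] using this
  rw [compl_eq_univ_sdiff, hinj.image_sdiff_subset (subset_univ _), himg, image_singleton,
    OpenPartialHomeomorph.univBall_apply_zero]

/-! ### Charts of a surface over its tangent plane -/

theorem HasGradientAt.hasFDerivAt_innerSL {f : Space → ℝ} {f' x : Space}
    (h : HasGradientAt f f' x) : HasFDerivAt f (innerSL ℝ f') x := 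
  h.hasFDerivAt.congr_fderiv (by ext; simp)

/-- A differentiable parametrization of `S` near `P` by a disc in the plane orthogonal to `N`,
which moves the points of the disc parallel to `N`. -/
structure IsGraphChart (S : Set Space) (P N : Space) (r : ℝ)
    (γ : (Submodule.span ℝ {N})ᗮ → Space) : Prop where
  pos : 0 < r
  map_zero : γ 0 = P
  differentiableOn : DifferentiableOn ℝ γ (ball 0 r)
  mem : ∀ w ∈ ball 0 r, γ w ∈ S
  exists_eq_add : ∀ w ∈ ball 0 r, ∃ s : ℝ, γ w = P + w + s • N
  image_mem : γ '' ball 0 r ∈ 𝓝[S] P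

namespace IsLocalEquation

variable {S U : Set Space} {P Q : Space} {g : Space → ℝ}

theorem of_mem (h : IsLocalEquation S P U g) (hQ : Q ∈ U) : IsLocalEquation S Q U g :=
  ⟨h.isOpen, hQ, h.contDiffOn, h.gradient_ne_zero, h.mem_iff⟩

theorem inter (h : IsLocalEquation S P U g) {V : Set Space} (hV : V ∈ 𝓝 P) :
    IsLocalEquation S P (U ∩ interior V) g :=
  ⟨h.isOpen.inter isOpen_interior, ⟨h.mem, mem_interior_iff_mem_nhds.2 hV⟩,
    h.contDiffOn.mono inter_subset_left, fun Q hQ => h.gradient_ne_zero Q hQ.1,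
    fun Q hQ => h.mem_iff Q hQ.1⟩

theorem contDiffAt (h : IsLocalEquation S P U g) (hQ : Q ∈ U) : ContDiffAt ℝ 1 g Q :=
  h.contDiffOn.contDiffAt (h.isOpen.mem_nhds hQ)

theorem hasFDerivAt (h : IsLocalEquation S P U g) (hQ : Q ∈ U) :
    HasFDerivAt g (innerSL ℝ (gradient g Q)) Q :=
  ((h.contDiffAt hQ).differentiableAt one_ne_zero).hasGradientAt.hasFDerivAt_innerSL

theorem continuousOn_gradient (h : IsLocalEquation S P U g) : ContinuousOn (gradient g) U :=
  (InnerProductSpace.toDual ℝ Space).symm.continuous.comp_continuousOn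
    (h.contDiffOn.continuousOn_fderiv_of_isOpen h.isOpen le_rfl)

theorem exists_graphChart (h : IsLocalEquation S P U g) (hP : P ∈ S) :
    ∃ r γ, IsGraphChart S P (gradient g P) r γ ∧ ∀ w ∈ ball 0 r, γ w ∈ U := by
  set N := gradient g P with hN
  have hN0 : N ≠ 0 := h.gradient_ne_zero P h.mem
  have hNN : ⟪N, N⟫ ≠ 0 := inner_self_ne_zero.2 hN0
  have hgP : g P = 0 := (h.mem_iff P h.mem).1 hP
  -- `G` replaces the `N`-coordinate of `x - P` by the value of `g`, suitably scaled. It straightens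
  -- `S` to the tangent plane, moves points only along `N`, and has derivative the identity at `P`,
  -- so its local inverse restricted to `P + Nᗮ` is the chart.
  set G : Space → Space := fun x => x + ((g x - ⟪N, x - P⟫) * ⟪N, N⟫⁻¹) • N with hG
  have hGP : G P = P := by simp [hG, hgP]
  have hGN (x : Space) : ⟪N, G x - P⟫ = g x := by
    simp only [hG, add_sub_right_comm, inner_add_right, inner_smul_right]
    field_simp
    ring
  have hGd : ContDiffAt ℝ 1 G P := by
    have h1 := h.contDiffAt h.mem
    have h2 : ContDiffAt ℝ 1 (fun x : Space => ⟪N, x - P⟫) P :=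
      contDiffAt_const.inner ℝ (contDiffAt_id.sub contDiffAt_const)
    exact contDiffAt_id.add (((h1.sub h2).mul contDiffAt_const).smul contDiffAt_const)
  have hGf : HasFDerivAt G ((ContinuousLinearEquiv.refl ℝ Space : Space ≃L[ℝ] Space) :
      Space →L[ℝ] Space) P := by
    have h1 := h.hasFDerivAt h.mem
    have h2 : HasFDerivAt (fun x : Space => ⟪N, x - P⟫) (innerSL ℝ N) P :=
      (innerSL ℝ N).hasFDerivAt.comp P ((hasFDerivAt_id P).sub_const P)
    have h3 := (hasFDerivAt_id P).add (((h1.sub h2).mul_const ⟪N, N⟫⁻¹).smul_const N)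
    exact h3.congr_fderiv (by ext x; simp [hN])
  set Φ := hGd.toOpenPartialHomeomorph G hGf one_ne_zero with hΦ
  have hΦG : ∀ x, Φ x = G x := fun x => rfl
  have hPs : P ∈ Φ.source := hGd.mem_toOpenPartialHomeomorph_source hGf one_ne_zero
  have hPt : P ∈ Φ.target := by
    have := hGd.image_mem_toOpenPartialHomeomorph_target hGf one_ne_zero
    rwa [hGP] at this
  have hsP : Φ.symm P = P := by
    have := Φ.left_inv hPs
    rwa [hΦG, hGP] at this
  have hsd : ContDiffAt ℝ 1 Φ.symm P := by
    have := hGd.to_localInverse hGf one_ne_zero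
    rwa [hGP] at this
  have hev : ∀ᶠ y in 𝓝 P, y ∈ Φ.target ∧ Φ.symm y ∈ U ∧ DifferentiableAt ℝ Φ.symm y := by
    refine Eventually.and (Φ.open_target.mem_nhds hPt) (Eventually.and ?_ ?_)
    · have : ContinuousAt Φ.symm P := hsd.continuousAt
      exact this (by rw [hsP]; exact h.isOpen.mem_nhds h.mem)
    · exact (hsd.eventually (by simp)).mono fun y hy => hy.differentiableAt one_ne_zero
  obtain ⟨r, hr, hrb⟩ := Metric.eventually_nhds_iff_ball.1 hev
  have hball : ∀ w ∈ ball (0 : (Submodule.span ℝ {N})ᗮ) r, P + (w : Space) ∈ ball P r := by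
    intro w hw
    simpa using hw
  have hmem : ∀ w ∈ ball (0 : (Submodule.span ℝ {N})ᗮ) r, Φ (Φ.symm (P + w)) = P + w :=
    fun w hw => Φ.right_inv (hrb _ (hball w hw)).1
  have hperp : ∀ w : (Submodule.span ℝ {N})ᗮ, ⟪N, (w : Space)⟫ = 0 := fun w =>
    Submodule.mem_orthogonal_singleton_iff_inner_right.1 w.2
  refine ⟨r, fun w => Φ.symm (P + w), ⟨hr, by simpa using hsP, ?_, ?_, ?_, ?_⟩,
    fun w hw => (hrb _ (hball w hw)).2.1⟩
  · intro w hw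
    refine DifferentiableAt.differentiableWithinAt ?_
    exact DifferentiableAt.comp w (hrb _ (hball w hw)).2.2
      ((Submodule.subtypeL (Submodule.span ℝ {N})ᗮ).differentiableAt.const_add P)
  · intro w hw
    rw [h.mem_iff _ (hrb _ (hball w hw)).2.1, ← hGN, ← hΦG, hmem w hw]
    simpa using hperp w
  · intro w hw
    have h1 := hmem w hw
    rw [hΦG] at h1
    simp only [hG] at h1
    refine ⟨-((g (Φ.symm (P + w)) - ⟪N, Φ.symm (P + w) - P⟫) * ⟪N, N⟫⁻¹), ?_⟩
    rw [neg_smul]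
    exact eq_sub_of_add_eq h1 |>.trans (sub_eq_add_neg _ _)
  · have h1 : ∀ᶠ Q in 𝓝 P, Q ∈ Φ.source ∧ Q ∈ U ∧ G Q ∈ ball P r := by
      refine Eventually.and (Φ.open_source.mem_nhds hPs)
        (Eventually.and (h.isOpen.mem_nhds h.mem) ?_)
      exact hGd.continuousAt (by rw [hGP]; exact ball_mem_nhds P hr)
    filter_upwards [nhdsWithin_le_nhds h1, self_mem_nhdsWithin] with Q hQ hQS
    refine ⟨⟨G Q - P, ?_⟩, ?_, ?_⟩
    · rw [Submodule.mem_orthogonal_singleton_iff_inner_right, hGN]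
      exact (h.mem_iff Q hQ.2.1).1 hQS
    · simpa [dist_eq_norm] using hQ.2.2
    · simpa [hΦG] using Φ.left_inv hQ.1

theorem inner_gradient_fderiv_eq_zero (h : IsLocalEquation S P U g) {N : Space} {r : ℝ}
    {γ : (Submodule.span ℝ {N})ᗮ → Space} (hγ : IsGraphChart S Q N r γ)
    (hU : ∀ w ∈ ball 0 r, γ w ∈ U) {w : (Submodule.span ℝ {N})ᗮ} (hw : w ∈ ball 0 r)
    (v : (Submodule.span ℝ {N})ᗮ) : ⟪gradient g (γ w), fderiv ℝ γ w v⟫ = 0 := by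
  have hd := (hγ.differentiableOn.differentiableAt (isOpen_ball.mem_nhds hw)).hasFDerivAt
  have h1 := (h.hasFDerivAt (hU w hw)).comp w hd
  have h2 : g ∘ γ =ᶠ[𝓝 w] fun _ => 0 := by
    filter_upwards [isOpen_ball.mem_nhds hw] with x hx
    exact (h.mem_iff _ (hU x hx)).1 (hγ.mem x hx)
  have h3 := h1.unique ((hasFDerivAt_const (0 : ℝ) w).congr_of_eventuallyEq h2)
  simpa using DFunLike.congr_fun h3 v

end IsLocalEquation

/-! ### Unit gradients and the normal direction -/

/-- On `S` the function `φ` has the continuous unit vector field `u` as its gradient. -/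
structure HasUnitGradientOn (S : Set Space) (φ : Space → ℝ) (u : Space → Space) : Prop where
  hasStrictFDerivAt : ∀ P ∈ S, HasStrictFDerivAt φ (innerSL ℝ (u P)) P
  norm_eq_one : ∀ P ∈ S, ‖u P‖ = 1
  continuousOn : ContinuousOn u S

theorem IsNormalAt.ne_zero {S : Set Space} {P N : Space} (h : IsNormalAt S P N) : N ≠ 0 := by
  obtain ⟨U, g, hg, rfl⟩ := h
  exact hg.gradient_ne_zero P hg.mem

/-- Two unit vectors with inner product different from `±1` are linearly independent. -/
theorem eq_zero_of_smul_add_smul_eq_zero {u v : Space} (hu : ‖u‖ = 1) (hv : ‖v‖ = 1)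
    (ht : ⟪u, v⟫ ^ 2 ≠ 1) {a b : ℝ} (h : a • u + b • v = 0) : a = 0 ∧ b = 0 := by
  have h1 : ⟪u, a • u + b • v⟫ = 0 := by rw [h, inner_zero_right]
  have h2 : ⟪v, a • u + b • v⟫ = 0 := by rw [h, inner_zero_right]
  simp only [inner_add_right, inner_smul_right, real_inner_self_eq_norm_sq, hu, hv,
    real_inner_comm u v] at h1 h2
  have h3 : 1 - ⟪u, v⟫ ^ 2 ≠ 0 := fun h => ht (by linarith)
  constructor
  · exact (mul_eq_zero.1 (show a * (1 - ⟪u, v⟫ ^ 2) = 0 by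
      linear_combination h1 - ⟪u, v⟫ * h2)).resolve_right h3
  · exact (mul_eq_zero.1 (show b * (1 - ⟪u, v⟫ ^ 2) = 0 by
      linear_combination h2 - ⟪u, v⟫ * h1)).resolve_right h3

/-- The two alternatives for the sign are exclusive: `u + n v` and `u - n v` are independent unless
`n = 0`. -/
theorem eq_zero_of_add_smul_eq_smul {u v N : Space} (hu : ‖u‖ = 1) (hv : ‖v‖ = 1)
    (ht : ⟪u, v⟫ ^ 2 ≠ 1) {n : ℝ} (h₁ : ∃ a : ℝ, u + n • v = a • N)
    (h₂ : ∃ a : ℝ, u + (-n) • v = a • N) : n = 0 := by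
  obtain ⟨a, ha⟩ := h₁
  obtain ⟨b, hb⟩ := h₂
  have h : (b - a) • u + (n * (b + a)) • v = 0 := by
    have : b • (u + n • v) - a • (u + (-n) • v) = 0 := by
      rw [ha, hb, smul_smul, smul_smul, mul_comm, sub_self]
    rw [← this]
    module
  obtain ⟨h1, h2⟩ := eq_zero_of_smul_add_smul_eq_zero hu hv ht h
  rcases mul_eq_zero.1 h2 with h2 | h2
  · exact h2
  · have ha0 : a = 0 := by linarith
    have h3 : (1 : ℝ) • u + n • v = 0 := by rw [one_smul, ha, ha0, zero_smul]
    exact absurd (eq_zero_of_smul_add_smul_eq_zero hu hv ht h3).1 one_ne_zero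

/-- The right side is `‖N‖ ^ 2` times the component of `x` orthogonal to `N`. It is continuous in
`N` and `x`, which makes being parallel to `N` a closed condition. -/
theorem exists_eq_smul_iff {N x : Space} (hN : N ≠ 0) :
    (∃ a : ℝ, x = a • N) ↔ ⟪N, N⟫ • x - ⟪N, x⟫ • N = 0 := by
  constructor
  · rintro ⟨a, rfl⟩
    rw [inner_smul_right]
    module
  · intro h
    refine ⟨⟪N, N⟫⁻¹ * ⟪N, x⟫, ?_⟩
    rw [mul_smul, ← sub_eq_zero.1 h, smul_smul, inv_mul_cancel₀ (inner_self_ne_zero.2 hN),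
      one_smul]

/-- Lagrange multipliers: near `P` the surface is a level set of `g`, and `f`, being constant on it,
has an extremum at `P`. The multiplier of `f` is nonzero because the gradient of `g` is. -/
theorem IsNormalAt.exists_gradient_eq_smul {S : Set Space} {P N : Space} (hP : P ∈ S)
    (hN : IsNormalAt S P N) {f : Space → ℝ} {x : Space}
    (hf : HasStrictFDerivAt f (innerSL ℝ x) P) (hc : ∀ᶠ Q in 𝓝[S] P, f Q = f P) :
    ∃ a : ℝ, x = a • N := by
  have hN0 := hN.ne_zero
  obtain ⟨U, g, hg, rfl⟩ := hN
  have hgd : HasStrictFDerivAt g (innerSL ℝ (gradient g P)) P :=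
    (hg.contDiffAt hg.mem).hasStrictFDerivAt' (hg.hasFDerivAt hg.mem) one_ne_zero
  have hext : IsLocalExtrOn f {Q | g Q = g P} P := by
    refine Or.inl ?_
    have h1 : ∀ᶠ Q in 𝓝[{Q | g Q = g P}] P, Q ∈ S := by
      filter_upwards [nhdsWithin_le_nhds (hg.isOpen.mem_nhds hg.mem), self_mem_nhdsWithin]
        with Q hQ hQg
      rw [hg.mem_iff Q hQ]
      exact Eq.trans hQg ((hg.mem_iff P hg.mem).1 hP)
    have h2 := eventually_nhdsWithin_iff.1 hc
    filter_upwards [h1, nhdsWithin_le_nhds h2] with Q hQ hQ'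
    exact (hQ' hQ).ge
  obtain ⟨a, b, hab, h⟩ := hext.exists_multipliers_of_hasStrictFDerivAt_1d hgd hf
  have h' : a • gradient g P + b • x = 0 := by
    refine ext_inner_right ℝ fun y => ?_
    simpa [inner_add_left, inner_smul_left] using DFunLike.congr_fun h y
  have hb : b ≠ 0 := by
    rintro rfl
    simp only [zero_smul, add_zero, smul_eq_zero, hN0, or_false] at h'
    exact hab (by rw [h']; rfl)
  refine ⟨-(b⁻¹ * a), ?_⟩
  have h3 : x = b⁻¹ • (b • x) := by rw [smul_smul, inv_mul_cancel₀ hb, one_smul]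
  rw [h3, eq_neg_of_add_eq_zero_right h']
  module

/-- Near each of its points a surface has points outside a given line. -/
theorem IsSmoothConnectedSurface.exists_notMem_line {S : Set Space}
    (hS : IsSmoothConnectedSurface S) {P : Space} (hP : P ∈ S) {V : Set Space} (hV : V ∈ 𝓝 P)
    (A d : Space) : ∃ Q ∈ S, Q ∈ V ∧ ¬ ∃ a : ℝ, Q - A = a • d := by
  obtain ⟨U, g, hg⟩ := hS.exists_equation P hP
  obtain ⟨N, r, γ, hγ, hU⟩ : ∃ N r γ, IsGraphChart S P N r γ ∧ ∀ w ∈ ball 0 r,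
    γ w ∈ U ∩ interior V := ⟨_, (hg.inter hV).exists_graphChart hP⟩
  have hVγ : ∀ w ∈ ball 0 r, γ w ∈ V := fun w hw => interior_subset (hU w hw).2
  -- Along the given line `⟪v, ·⟫` is constant since `v ⟂ d`. In the chart it equals `⟪v, P⟫ + ⟪v,
  -- w⟫` since `v ⟂ N`, and it varies when `w` runs along `v`.
  obtain ⟨v, hv, hv0⟩ : ∃ v ∈ (Submodule.span ℝ {N, d})ᗮ, v ≠ 0 := by
    refine Submodule.exists_mem_ne_zero_of_ne_bot fun hbot => ?_
    rw [Submodule.orthogonal_eq_bot_iff] at hbot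
    have h1 := finrank_span_le_card (R := ℝ) ({N, d} : Set Space)
    rw [hbot, finrank_top, finrank_euclideanSpace_fin] at h1
    have h2 : ({N, d} : Set Space).toFinset.card ≤ 2 := by
      rw [Set.toFinset_insert, Set.toFinset_singleton]
      exact Finset.card_le_two
    omega
  have hvN : ⟪v, N⟫ = 0 := Submodule.inner_left_of_mem_orthogonal
    (Submodule.subset_span (by simp)) hv
  have hvd : ⟪v, d⟫ = 0 := Submodule.inner_left_of_mem_orthogonal
    (Submodule.subset_span (by simp)) hv
  by_contra! hline
  have hconst : ∀ w ∈ ball 0 r, ⟪v, γ w⟫ = ⟪v, A⟫ := by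
    intro w hw
    obtain ⟨a, ha⟩ := hline _ (hγ.mem w hw) (hVγ w hw)
    rw [eq_add_of_sub_eq ha, inner_add_right, inner_smul_right, hvd]
    ring
  have hval : ∀ w ∈ ball 0 r, ⟪v, γ w⟫ = ⟪v, P⟫ + ⟪v, (w : Space)⟫ := by
    intro w hw
    obtain ⟨s, hs⟩ := hγ.exists_eq_add w hw
    rw [hs, inner_add_right, inner_add_right, inner_smul_right, hvN]
    ring
  have hvW : v ∈ (Submodule.span ℝ {N})ᗮ := by
    rw [Submodule.mem_orthogonal_singleton_iff_inner_left]
    exact hvN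
  have hv0' : 0 < ‖v‖ := norm_pos_iff.2 hv0
  have hr := hγ.pos
  set w : (Submodule.span ℝ {N})ᗮ := (r / 2 * ‖v‖⁻¹) • ⟨v, hvW⟩
  have hw : w ∈ ball 0 r := by
    rw [mem_ball_zero_iff, norm_smul, Submodule.coe_norm, Real.norm_of_nonneg (by positivity),
      mul_assoc, inv_mul_cancel₀ hv0'.ne']
    linarith
  have h0 : (0 : (Submodule.span ℝ {N})ᗮ) ∈ ball 0 r := mem_ball_self hr
  have h1 := (hval w hw).symm.trans ((hconst w hw).trans ((hconst 0 h0).symm.trans (hval 0 h0)))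
  simp only [w, Submodule.coe_smul, inner_smul_right, Submodule.coe_zero, inner_zero_right,
    add_right_inj, real_inner_self_eq_norm_sq] at h1
  have : 0 < r / 2 * ‖v‖⁻¹ * ‖v‖ ^ 2 := by positivity
  exact this.ne' h1

/-- The chain rule pairs a multiple of the normal with tangent vectors, so the derivative of `f ∘ γ`
vanishes. The set `D` is separate from the disc because in the application normality is known only
off the centre. -/
theorem IsLocalEquation.comp_graphChart_eq {S U : Set Space} {P Q N : Space} {g : Space → ℝ}
    (h : IsLocalEquation S P U g) {r : ℝ} {γ : (Submodule.span ℝ {N})ᗮ → Space}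
    (hγ : IsGraphChart S Q N r γ) (hU : ∀ w ∈ ball 0 r, γ w ∈ U)
    {D : Set (Submodule.span ℝ {N})ᗮ} (hDo : IsOpen D) (hD : IsPreconnected D)
    (hDr : D ⊆ ball 0 r) {f : Space → ℝ} {F : Space → Space}
    (hf : ∀ R ∈ S, HasFDerivAt f (innerSL ℝ (F R)) R)
    (hF : ∀ w ∈ D, ∃ a : ℝ, F (γ w) = a • gradient g (γ w)) :
    ∃ c, ∀ w ∈ D, f (γ w) = c := by
  have hd : ∀ w ∈ D, HasFDerivAt (f ∘ γ) ((innerSL ℝ (F (γ w))).comp (fderiv ℝ γ w)) w :=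
    fun w hw => (hf _ (hγ.mem w (hDr hw))).comp w
      (hγ.differentiableOn.differentiableAt (isOpen_ball.mem_nhds (hDr hw))).hasFDerivAt
  refine hDo.exists_is_const_of_fderiv_eq_zero hD
    (fun w hw => (hd w hw).differentiableAt.differentiableWithinAt) fun w hw => ?_
  refine (hd w hw).fderiv.trans ?_
  obtain ⟨a, ha⟩ := hF w hw
  ext v
  simp [ha, h.inner_gradient_fderiv_eq_zero hγ hU (hDr hw) v]

/-! ### One sign and one constant on the whole surface -/

/-- The points of `S` at which the unit vectors `u` and `v` are parallel lie on a line, whose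
direction is that of `u` at these points. -/
def IsParallelOnLine (S : Set Space) (u v : Space → Space) : Prop :=
  ∃ A d : Space, ∀ Q ∈ S, ⟪u Q, v Q⟫ ^ 2 = 1 →
    (∃ a : ℝ, Q - A = a • d) ∧ ∃ b : ℝ, d = b • u Q

section

variable {S : Set Space} {φ ψ : Space → ℝ} {u v : Space → Space}

theorem IsSmoothConnectedSurface.exists_inner_sq_ne_one (hS : IsSmoothConnectedSurface S)
    (hL : IsParallelOnLine S u v) {P : Space} (hP : P ∈ S) {V : Set Space} (hV : V ∈ 𝓝 P) :
    ∃ Q ∈ S, Q ∈ V ∧ ⟪u Q, v Q⟫ ^ 2 ≠ 1 := by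
  obtain ⟨A, d, h⟩ := hL
  obtain ⟨Q, hQ, hQV, hQl⟩ := hS.exists_notMem_line hP hV A d
  exact ⟨Q, hQ, hQV, fun ht => hQl (h Q hQ ht).1⟩

theorem HasUnitGradientOn.hasStrictFDerivAt_add_mul (hφ : HasUnitGradientOn S φ u)
    (hψ : HasUnitGradientOn S ψ v) (m : ℝ) {P : Space} (hP : P ∈ S) :
    HasStrictFDerivAt (fun Q => φ Q + m * ψ Q) (innerSL ℝ (u P + m • v P)) P := by
  refine ((hφ.hasStrictFDerivAt P hP).add
    ((hψ.hasStrictFDerivAt P hP).const_mul m)).congr_fderiv ?_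
  ext x
  simp

/-- The difference of two points of the exceptional line is a multiple of `u P`, hence of `N`; in
the chart it is also `w` plus a multiple of `N`, with `w ⟂ N`. -/
theorem IsParallelOnLine.eq_zero_of_graphChart (hL : IsParallelOnLine S u v) {P N : Space} {r : ℝ}
    {γ : (Submodule.span ℝ {N})ᗮ → Space} (hγ : IsGraphChart S P N r γ) (hP : P ∈ S)
    (hN : N ≠ 0) (ht : ⟪u P, v P⟫ ^ 2 = 1) (hu : ∃ a : ℝ, u P = a • N)
    {w : (Submodule.span ℝ {N})ᗮ} (hw : w ∈ ball 0 r) (htw : ⟪u (γ w), v (γ w)⟫ ^ 2 = 1) :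
    w = 0 := by
  obtain ⟨A, d, h⟩ := hL
  obtain ⟨⟨a, ha⟩, b, hb⟩ := h P hP ht
  obtain ⟨⟨a', ha'⟩, -⟩ := h _ (hγ.mem w hw) htw
  obtain ⟨k, hk⟩ := hu
  obtain ⟨s, hs⟩ := hγ.exists_eq_add w hw
  have h1 : (w : Space) = ((a' - a) * b * k - s) • N := by
    have h2 : (w : Space) = (γ w - A) - (P - A) - s • N := by rw [hs]; module
    rw [h2, ha, ha', hb, hk]
    module
  have h3 : ⟪N, (w : Space)⟫ = 0 := Submodule.mem_orthogonal_singleton_iff_inner_right.1 w.2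
  rw [h1, inner_smul_right] at h3
  have h4 := (mul_eq_zero.1 h3).resolve_right (inner_self_ne_zero.2 hN)
  rw [h4, zero_smul] at h1
  exact_mod_cast h1

/-- The dichotomy for the normal of a perfect lens at `P`. -/
def IsRefracting (S : Set Space) (u v : Space → Space) (n : ℝ) : Prop :=
  ∀ P ∈ S, ∀ N, IsNormalAt S P N →
    (⟪u P, v P⟫ ^ 2 = 1 → ∃ a : ℝ, u P = a • N) ∧
    (⟪u P, v P⟫ ^ 2 ≠ 1 →
      (∃ a : ℝ, u P + n • v P = a • N) ∨ ∃ a : ℝ, u P + (-n) • v P = a • N)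

theorem IsPreconnected.exists_add_smul_eq_smul {X : Type*} [TopologicalSpace X] {D : Set X}
    (hD : IsPreconnected D) (hDo : IsOpen D) {a b N : X → Space} (ha : ContinuousOn a D)
    (hb : ContinuousOn b D) (hN : ContinuousOn N D) (ha1 : ∀ w ∈ D, ‖a w‖ = 1)
    (hb1 : ∀ w ∈ D, ‖b w‖ = 1) (ht : ∀ w ∈ D, ⟪a w, b w⟫ ^ 2 ≠ 1) (hN0 : ∀ w ∈ D, N w ≠ 0) {n : ℝ}
    (hor : ∀ w ∈ D, (∃ k : ℝ, a w + n • b w = k • N w) ∨ ∃ k : ℝ, a w + (-n) • b w = k • N w) :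
    ∃ m : ℝ, (m = n ∨ m = -n) ∧ ∀ w ∈ D, ∃ k : ℝ, a w + m • b w = k • N w := by
  by_cases hn0 : n = 0
  · refine ⟨0, Or.inl hn0.symm, fun w hw => ?_⟩
    simpa [hn0] using hor w hw
  -- `T m` is the open set where alternative `m` fails. `T n` and `T (-n)` are disjoint because some
  -- alternative holds, and cover `D` because not both do.
  set T : ℝ → Set X := fun m => {w ∈ D | ¬ ∃ k : ℝ, a w + m • b w = k • N w} with hT
  have hTo : ∀ m, IsOpen (T m) := by
    intro m
    have hsum : ContinuousOn (fun w => a w + m • b w) D := ha.add (hb.const_smul m)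
    have h1 : ContinuousOn (fun w => ⟪N w, N w⟫) D := ContinuousOn.inner (𝕜 := ℝ) hN hN
    have h2 : ContinuousOn (fun w => ⟪N w, a w + m • b w⟫) D :=
      ContinuousOn.inner (𝕜 := ℝ) hN hsum
    have hc : ContinuousOn (fun w => ⟪N w, N w⟫ • (a w + m • b w) -
        ⟪N w, a w + m • b w⟫ • N w) D := (h1.smul hsum).sub (h2.smul hN)
    convert hc.isOpen_inter_preimage hDo (isOpen_compl_singleton (x := 0)) using 1
    ext w
    refine and_congr_right fun hw => ?_
    rw [exists_eq_smul_iff (hN0 w hw)]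
    rfl
  have hdisj : Disjoint (T n) (T (-n)) := by
    rw [Set.disjoint_left]
    exact fun w h1 h2 => (hor w h1.1).elim h1.2 h2.2
  have hcov : D ⊆ T n ∪ T (-n) := by
    intro w hw
    by_contra hcon
    have h1 : ∃ k : ℝ, a w + n • b w = k • N w := by
      by_contra h
      exact hcon (Or.inl ⟨hw, h⟩)
    have h2 : ∃ k : ℝ, a w + (-n) • b w = k • N w := by
      by_contra h
      exact hcon (Or.inr ⟨hw, h⟩)
    exact hn0 (eq_zero_of_add_smul_eq_smul (ha1 w hw) (hb1 w hw) (ht w hw) h1 h2)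
  rcases hD.subset_or_subset (hTo n) (hTo (-n)) hdisj hcov with h | h
  · exact ⟨-n, Or.inr rfl, fun w hw => (hor w hw).resolve_left (h hw).2⟩
  · exact ⟨n, Or.inl rfl, fun w hw => (hor w hw).resolve_right (h hw).2⟩

theorem IsRefracting.eventually_eq (hS : IsSmoothConnectedSurface S)
    (hφ : HasUnitGradientOn S φ u) (hψ : HasUnitGradientOn S ψ v) (hL : IsParallelOnLine S u v)
    {n : ℝ} (hR : IsRefracting S u v n) {P : Space} (hP : P ∈ S) :
    ∃ m : ℝ, (m = n ∨ m = -n) ∧ ∀ᶠ Q in 𝓝[S] P, φ Q + m * ψ Q = φ P + m * ψ P := by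
  obtain ⟨U, g, hg⟩ := hS.exists_equation P hP
  have htc : ContinuousOn (fun Q => ⟪u Q, v Q⟫ ^ 2) S :=
    (hφ.continuousOn.inner hψ.continuousOn).pow 2
  -- If the rays at `P` are independent, they stay so on a small `V`. If they are parallel, no
  -- shrinking is needed: the chart meets the exceptional line only at its centre.
  obtain ⟨V, hV, hVt⟩ : ∃ V ∈ 𝓝 P, ⟪u P, v P⟫ ^ 2 ≠ 1 →
      ∀ Q ∈ V, Q ∈ S → ⟪u Q, v Q⟫ ^ 2 ≠ 1 := by
    by_cases ht : ⟪u P, v P⟫ ^ 2 = 1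
    · exact ⟨univ, univ_mem, fun h => absurd ht h⟩
    · have h1 := eventually_nhdsWithin_iff.1 ((htc P hP).eventually_ne ht)
      exact ⟨_, h1, fun _ Q hQ => hQ⟩
  have hg' := hg.inter hV
  have hN0 : gradient g P ≠ 0 := hg.gradient_ne_zero P hg.mem
  have hn : ∀ Q ∈ U, IsNormalAt S Q (gradient g Q) := fun Q hQ => ⟨U, g, hg.of_mem hQ, rfl⟩
  have hRP := (hR P hP _ (hn P hg.mem)).1
  obtain ⟨N, hNP, hN, r, γ, hγ, hU⟩ : ∃ N, gradient g P = N ∧ N ≠ 0 ∧ ∃ r γ,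
    IsGraphChart S P N r γ ∧ ∀ w ∈ ball 0 r, γ w ∈ U ∩ interior V :=
      ⟨_, rfl, hN0, hg'.exists_graphChart hP⟩
  rw [hNP] at hRP
  set D : Set (Submodule.span ℝ {N})ᗮ := ball 0 r \ {0} with hD
  have hDb : D ⊆ ball 0 r := sdiff_subset
  have hDo : IsOpen D := isOpen_ball.sdiff isClosed_singleton
  have hDc : IsConnected D := by
    refine isConnected_ball_diff_singleton (Module.one_lt_rank_of_one_lt_finrank ?_) 0 hγ.pos
    have : Fact (Module.finrank ℝ Space = 2 + 1) := ⟨finrank_euclideanSpace_fin⟩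
    rw [Submodule.finrank_orthogonal_span_singleton (n := 2) hN]
    norm_num
  have htD : ∀ w ∈ D, ⟪u (γ w), v (γ w)⟫ ^ 2 ≠ 1 := by
    intro w hw htw
    by_cases ht : ⟪u P, v P⟫ ^ 2 = 1
    · exact hw.2 (hL.eq_zero_of_graphChart hγ hP hN ht (hRP ht) (hDb hw) htw)
    · exact hVt ht _ (interior_subset (hU w (hDb hw)).2) (hγ.mem w (hDb hw)) htw
  have hnγ : ∀ w ∈ D, IsNormalAt S (γ w) (gradient g (γ w)) :=
    fun w hw => hn _ (hU w (hDb hw)).1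
  have hor : ∀ w ∈ D, (∃ a : ℝ, u (γ w) + n • v (γ w) = a • gradient g (γ w)) ∨
      ∃ a : ℝ, u (γ w) + (-n) • v (γ w) = a • gradient g (γ w) := fun w hw =>
    (hR _ (hγ.mem w (hDb hw)) _ (hnγ w hw)).2 (htD w hw)
  obtain ⟨m, hm, hmD⟩ : ∃ m : ℝ, (m = n ∨ m = -n) ∧
      ∀ w ∈ D, ∃ a : ℝ, u (γ w) + m • v (γ w) = a • gradient g (γ w) := by
    have hmaps : MapsTo γ D S := fun w hw => hγ.mem w (hDb hw)
    have hγc : ContinuousOn γ D := hγ.differentiableOn.continuousOn.mono hDb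
    exact hDc.isPreconnected.exists_add_smul_eq_smul hDo (hφ.continuousOn.comp hγc hmaps)
      (hψ.continuousOn.comp hγc hmaps)
      (hg.continuousOn_gradient.comp hγc fun w hw => (hU w (hDb hw)).1)
      (fun w hw => hφ.norm_eq_one _ (hmaps hw)) (fun w hw => hψ.norm_eq_one _ (hmaps hw)) htD
      (fun w hw => (hnγ w hw).ne_zero) hor
  refine ⟨m, hm, ?_⟩
  have hfd : ∀ R ∈ S, HasFDerivAt (fun Q => φ Q + m * ψ Q) (innerSL ℝ (u R + m • v R)) R :=
    fun R hR => (hφ.hasStrictFDerivAt_add_mul hψ m hR).hasFDerivAt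
  obtain ⟨c, hc⟩ := hg.comp_graphChart_eq hγ (fun w hw => (hU w hw).1) hDo hDc.isPreconnected hDb
    (F := fun R => u R + m • v R) hfd hmD
  have h0 : (0 : (Submodule.span ℝ {N})ᗮ) ∈ ball 0 r := mem_ball_self hγ.pos
  -- The centre of the disc is a limit of points of `D`, so the constant extends to `P` by
  -- continuity.
  have hcP : φ P + m * ψ P = c := by
    have hγ0 : ContinuousAt γ 0 :=
      (hγ.differentiableOn.differentiableAt (isOpen_ball.mem_nhds h0)).continuousAt
    have hf0 : ContinuousAt (fun Q => φ Q + m * ψ Q) (γ 0) := by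
      rw [hγ.map_zero]
      exact (hfd P hP).continuousAt
    have h1 : ContinuousWithinAt (fun w => φ (γ w) + m * ψ (γ w)) D 0 :=
      (hf0.comp hγ0).continuousWithinAt
    have h2 : (0 : (Submodule.span ℝ {N})ᗮ) ∈ closure D := by
      have : Nontrivial (Submodule.span ℝ {N})ᗮ := by
        obtain ⟨w, hw⟩ := hDc.nonempty
        exact ⟨w, 0, hw.2⟩
      have h3 : (𝓝[≠] (0 : (Submodule.span ℝ {N})ᗮ)).NeBot :=
        Module.punctured_nhds_neBot ℝ _ _
      rw [mem_closure_iff_nhdsWithin_neBot, hD, sdiff_eq, inter_comm, nhdsWithin_inter_of_mem']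
      · exact h3
      · exact nhdsWithin_le_nhds (isOpen_ball.mem_nhds h0)
    have h3 := h1.mem_closure h2 (t := {c}) fun w hw => hc w hw
    simpa [hγ.map_zero] using h3
  filter_upwards [hγ.image_mem] with Q hQ
  obtain ⟨w, hw, rfl⟩ := hQ
  rw [hcP]
  by_cases hw0 : w = 0
  · rw [hw0, hγ.map_zero, hcP]
  · exact hc w ⟨hw, hw0⟩

theorem IsRefracting.exists_eq (hS : IsSmoothConnectedSurface S)
    (hφ : HasUnitGradientOn S φ u) (hψ : HasUnitGradientOn S ψ v) (hL : IsParallelOnLine S u v)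
    {n : ℝ} (hR : IsRefracting S u v n) :
    ∃ m c : ℝ, (m = n ∨ m = -n) ∧ ∀ P ∈ S, φ P + m * ψ P = c := by
  have : PreconnectedSpace S := isPreconnected_iff_preconnectedSpace.1 hS.isConnected.isPreconnected
  obtain ⟨P₀, hP₀⟩ := hS.isConnected.nonempty
  set A : ℝ → Set S := fun m =>
    {x : S | ∀ᶠ y : S in 𝓝 x, φ y + m * ψ y = φ x + m * ψ x} with hA
  have hmem (m : ℝ) (x : S) :
      x ∈ A m ↔ ∀ᶠ Q in 𝓝[S] (x : Space), φ Q + m * ψ Q = φ x + m * ψ x := by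
    rw [nhdsWithin_eq_map_subtype_coe x.2]
    rfl
  have hopen : ∀ m, IsOpen (A m) := by
    intro m
    rw [isOpen_iff_mem_nhds]
    intro x hx
    have hx' : ∀ᶠ y : S in 𝓝 x, φ y + m * ψ y = φ x + m * ψ x := hx
    filter_upwards [eventually_eventually_nhds.2 hx', hx'] with y hy hxy
    change ∀ᶠ z : S in 𝓝 y, φ z + m * ψ z = φ y + m * ψ y
    filter_upwards [hy] with z hz
    rw [hz, hxy]
  suffices h : ∃ m, (m = n ∨ m = -n) ∧ A m = univ by
    obtain ⟨m, hmn, hm⟩ := h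
    have hlc : IsLocallyConstant fun x : S => φ x + m * ψ x :=
      (IsLocallyConstant.iff_eventually_eq _).2 fun x => by
        have : x ∈ A m := hm ▸ mem_univ x
        exact this
    exact ⟨m, φ P₀ + m * ψ P₀, hmn, fun P hP =>
      hlc.apply_eq_of_preconnectedSpace ⟨P, hP⟩ ⟨P₀, hP₀⟩⟩
  have hcov : ∀ x : S, x ∈ A n ∨ x ∈ A (-n) := by
    intro x
    obtain ⟨m, rfl | rfl, hm⟩ := hR.eventually_eq hS hφ hψ hL x.2
    · exact Or.inl ((hmem _ x).2 hm)
    · exact Or.inr ((hmem _ x).2 hm)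
  by_cases hn0 : n = 0
  · refine ⟨n, Or.inl rfl, eq_univ_of_forall fun x => ?_⟩
    simpa [hn0] using hcov x
  -- If both combinations were constant near `x`, then at a nearby point with independent rays both
  -- `u + n v` and `u - n v` would be normal, forcing `n = 0`.
  have hdisj : Disjoint (A n) (A (-n)) := by
    rw [Set.disjoint_left]
    intro x h1 h2
    rw [hmem] at h1 h2
    have h3 := eventually_eventually_nhdsWithin.2 (h1.and h2)
    obtain ⟨V, hV, hVS⟩ := mem_nhdsWithin_iff_exists_mem_nhds_inter.1 (h3.and (h1.and h2))
    obtain ⟨Q, hQ, hQV, hQt⟩ := hS.exists_inner_sq_ne_one hL x.2 hV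
    obtain ⟨hQ1, hQ2, hQ3⟩ := hVS ⟨hQV, hQ⟩
    obtain ⟨U, g, hg⟩ := hS.exists_equation Q hQ
    have hN : IsNormalAt S Q (gradient g Q) := ⟨U, g, hg, rfl⟩
    refine hn0 (eq_zero_of_add_smul_eq_smul (hφ.norm_eq_one Q hQ) (hψ.norm_eq_one Q hQ) hQt
      (hN.exists_gradient_eq_smul hQ (hφ.hasStrictFDerivAt_add_mul hψ n hQ) ?_)
      (hN.exists_gradient_eq_smul hQ (hφ.hasStrictFDerivAt_add_mul hψ (-n) hQ) ?_))
    · exact hQ1.mono fun R hR => hR.1.trans hQ2.symm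
    · exact hQ1.mono fun R hR => hR.2.trans hQ3.symm
  have hclopen : IsClopen (A n) := by
    refine ⟨⟨?_⟩, hopen n⟩
    convert hopen (-n) using 1
    ext x
    exact ⟨fun h => (hcov x).resolve_left h, fun h h' => Set.disjoint_left.1 hdisj h' h⟩
  rcases isClopen_iff.1 hclopen with h | h
  · refine ⟨-n, Or.inr rfl, eq_univ_of_forall fun x => (hcov x).resolve_left ?_⟩
    rw [h]
    exact notMem_empty x
  · exact ⟨n, Or.inl rfl, h⟩

end

/-! ### The sine law and the criterion for a perfect lens -/

/-- Both sides are the area of the parallelogram on `u` and `a u + b v`, which is `|b|` times that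
on `u` and `v`. -/
theorem sin_angle_mul_norm_smul_add_smul {u v : Space} (hu : ‖u‖ = 1) (hv : ‖v‖ = 1) (a b : ℝ) :
    Real.sin (InnerProductGeometry.angle u (a • u + b • v)) * ‖a • u + b • v‖ =
      |b| * √(1 - ⟪u, v⟫ ^ 2) := by
  have h := InnerProductGeometry.sin_angle_mul_norm_mul_norm u (a • u + b • v)
  rw [hu, one_mul] at h
  rw [h, ← Real.sqrt_sq_eq_abs, ← Real.sqrt_mul (sq_nonneg b)]
  congr 1
  simp only [inner_add_right, inner_add_left, inner_smul_right, real_inner_smul_left,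
    real_inner_self_eq_norm_sq, hu, hv, real_inner_comm u v]
  ring

theorem eq_inner_smul_of_inner_sq_eq_one {a b : Space} (ha : ‖a‖ = 1) (hb : ‖b‖ = 1)
    (ht : ⟪a, b⟫ ^ 2 = 1) : b = ⟪a, b⟫ • a := by
  rw [← sub_eq_zero, ← norm_eq_zero, ← sq_eq_zero_iff, ← real_inner_self_eq_norm_sq]
  simp only [inner_sub_left, inner_sub_right, real_inner_smul_left, inner_smul_right,
    real_inner_self_eq_norm_sq, ha, hb, real_inner_comm a b]
  linear_combination -ht

section

variable {S : Set Space} {F F' : Focus} {φ ψ : Space → ℝ} {u v : Space → Space}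

/-- Where the rays are parallel the span condition alone puts `N` on the line of `u`. Elsewhere the
common factor `√(1 - ⟪u, v⟫ ^ 2)` cancels from the sine law, leaving `n |a| = |b|`. -/
theorem IsPerfectLens.exists_isRefracting (hu : ∀ P ∈ S, ‖u P‖ = 1) (hv : ∀ P ∈ S, ‖v P‖ = 1)
    (hF : ∀ P ∈ S, ∃ r : ℝ, 0 < r ∧ F.ray P = r • u P) (hF' : ∀ P ∈ S, ∃ r : ℝ, 0 < r ∧ F'.ray P = r • v P)
    (h : IsPerfectLens S F F') : ∃ n, IsRefracting S u v n := by
  obtain ⟨hspan, n, hn⟩ := h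
  refine ⟨n, fun P hP N hN => ?_⟩
  obtain ⟨r, hr, hFr⟩ := hF P hP
  obtain ⟨r', hr', hFr'⟩ := hF' P hP
  have h1 := hspan P hP N hN
  have h2 := hn P hP N hN
  rw [hFr, hFr', InnerProductGeometry.angle_smul_left_of_pos _ _ hr,
    InnerProductGeometry.angle_smul_left_of_pos _ _ hr'] at h2
  rw [hFr, hFr', Submodule.mem_span_pair] at h1
  obtain ⟨a', b', hab⟩ := h1
  obtain ⟨a, b, rfl⟩ : ∃ a b : ℝ, N = a • u P + b • v P :=
    ⟨a' * r, b' * r', by rw [← hab, smul_smul, smul_smul]⟩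
  have hN0 := hN.ne_zero
  have hu1 := hu P hP
  have hv1 := hv P hP
  constructor
  · intro ht
    have huv := eq_inner_smul_of_inner_sq_eq_one hu1 hv1 ht
    set t := ⟪u P, v P⟫
    have hN' : a • u P + b • v P = (a + b * t) • u P := by
      rw [huv]
      module
    have hab0 : a + b * t ≠ 0 := fun h0 => hN0 (by rw [hN', h0, zero_smul])
    exact ⟨(a + b * t)⁻¹, by rw [hN', smul_smul, inv_mul_cancel₀ hab0, one_smul]⟩
  · intro ht
    have ht' : ⟪u P, v P⟫ ^ 2 ≤ 1 := by
      rw [sq_le_one_iff_abs_le_one]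
      simpa [hu1, hv1] using abs_real_inner_le_norm (u P) (v P)
    have hsq : 0 < √(1 - ⟪u P, v P⟫ ^ 2) := Real.sqrt_pos.2 (sub_pos.2 (lt_of_le_of_ne ht' ht))
    have h3 := sin_angle_mul_norm_smul_add_smul hu1 hv1 a b
    have h4 := sin_angle_mul_norm_smul_add_smul hv1 hu1 b a
    rw [add_comm, real_inner_comm] at h4
    rw [h2, mul_assoc, h4, ← mul_assoc] at h3
    have h5 : n * |a| = |b| := mul_right_cancel₀ hsq.ne' h3
    have ha : a ≠ 0 := by
      rintro rfl
      have hb : b = 0 := by simpa using h5.symm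
      exact hN0 (by simp [hb])
    have h6 : b = n * a ∨ b = -n * a := by
      rcases abs_cases a with ⟨ha', -⟩ | ⟨ha', -⟩ <;> rcases abs_cases b with ⟨hb', -⟩ | ⟨hb', -⟩ <;>
        rw [ha', hb'] at h5
      · exact Or.inl h5.symm
      · exact Or.inr (by linarith)
      · exact Or.inr (by linarith)
      · exact Or.inl (by linarith)
    refine h6.imp (fun h => ⟨a⁻¹, ?_⟩) fun h => ⟨a⁻¹, ?_⟩ <;>
    · rw [h, smul_add, smul_smul, smul_smul, inv_mul_cancel₀ ha, one_smul, mul_comm, mul_assoc,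
        mul_inv_cancel₀ ha, mul_one]

theorem isPerfectLens_of_eq (hφ : HasUnitGradientOn S φ u) (hψ : HasUnitGradientOn S ψ v)
    (hF : ∀ P ∈ S, ∃ r : ℝ, 0 < r ∧ F.ray P = r • u P) (hF' : ∀ P ∈ S, ∃ r : ℝ, 0 < r ∧ F'.ray P = r • v P)
    {m c : ℝ} (h : ∀ P ∈ S, φ P + m * ψ P = c) (h0 : ∀ P ∈ S, u P + m • v P ≠ 0) :
    IsPerfectLens S F F' := by
  have hN : ∀ P ∈ S, ∀ N, IsNormalAt S P N → ∃ a : ℝ, N = a • u P + (a * m) • v P := by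
    intro P hP N hN
    obtain ⟨a, ha⟩ := hN.exists_gradient_eq_smul hP (hφ.hasStrictFDerivAt_add_mul hψ m hP)
      (eventually_mem_nhdsWithin.mono fun Q hQ => (h Q hQ).trans (h P hP).symm)
    have ha0 : a ≠ 0 := by
      rintro rfl
      exact h0 P hP (by rw [ha, zero_smul])
    refine ⟨a⁻¹, ?_⟩
    rw [mul_smul, ← smul_add, ha, smul_smul, inv_mul_cancel₀ ha0, one_smul]
  refine ⟨fun P hP N hNP => ?_, |m|, fun P hP N hNP => ?_⟩ <;>
    obtain ⟨r, hr, hFr⟩ := hF P hP <;> obtain ⟨r', hr', hFr'⟩ := hF' P hP <;>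
    have hN0 := hNP.ne_zero <;> obtain ⟨a, rfl⟩ := hN P hP N hNP
  · rw [hFr, hFr', Submodule.mem_span_pair]
    refine ⟨a * r⁻¹, a * m * r'⁻¹, ?_⟩
    rw [smul_smul, smul_smul, mul_assoc, inv_mul_cancel₀ hr.ne', mul_one, mul_assoc _ _ r',
      inv_mul_cancel₀ hr'.ne', mul_one]
  · rw [hFr, hFr', InnerProductGeometry.angle_smul_left_of_pos _ _ hr,
      InnerProductGeometry.angle_smul_left_of_pos _ _ hr']
    have h3 := sin_angle_mul_norm_smul_add_smul (hφ.norm_eq_one P hP) (hψ.norm_eq_one P hP) a (a * m)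
    have h4 := sin_angle_mul_norm_smul_add_smul (hψ.norm_eq_one P hP) (hφ.norm_eq_one P hP) (a * m) a
    rw [add_comm, real_inner_comm] at h4
    refine mul_right_cancel₀ (norm_ne_zero_iff.2 hN0) ?_
    rw [h3, mul_assoc, h4, abs_mul]
    ring

/-- Hypothesis `hE` handles the degenerate ovals: if `u + m v` vanishes at one point, then `m = ±1`
and `hE` spreads `⟪u, v⟫ = -m` over all of `S`, contradicting that `S` has points off the
exceptional line. -/
theorem isPerfectLens_iff_exists_eq (hS : IsSmoothConnectedSurface S)
    (hφ : HasUnitGradientOn S φ u) (hψ : HasUnitGradientOn S ψ v)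
    (hF : ∀ P ∈ S, ∃ r : ℝ, 0 < r ∧ F.ray P = r • u P) (hF' : ∀ P ∈ S, ∃ r : ℝ, 0 < r ∧ F'.ray P = r • v P)
    (hL : IsParallelOnLine S u v)
    (hE : ∀ m : ℝ, m ^ 2 = 1 → ∀ P ∈ S, ⟪u P, v P⟫ = -m → ∀ Q ∈ S, φ Q + m * ψ Q = φ P + m * ψ P →
      ⟪u Q, v Q⟫ = -m) :
    IsPerfectLens S F F' ↔ ∃ m c : ℝ, ∀ P ∈ S, φ P + m * ψ P = c := by
  constructor
  · intro h
    obtain ⟨n, hn⟩ := h.exists_isRefracting hφ.norm_eq_one hψ.norm_eq_one hF hF'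
    obtain ⟨m, c, -, hmc⟩ := hn.exists_eq hS hφ hψ hL
    exact ⟨m, c, hmc⟩
  · rintro ⟨m, c, h⟩
    refine isPerfectLens_of_eq hφ hψ hF hF' h fun P hP h0 => ?_
    have hu := eq_neg_of_add_eq_zero_left h0
    have hm : m ^ 2 = 1 := by
      have := hφ.norm_eq_one P hP
      rw [hu, norm_neg, norm_smul, hψ.norm_eq_one P hP, mul_one, Real.norm_eq_abs] at this
      rw [← sq_abs, this, one_pow]
    have ht : ⟪u P, v P⟫ = -m := by
      rw [hu, inner_neg_left, real_inner_smul_left, real_inner_self_eq_norm_sq,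
        hψ.norm_eq_one P hP]
      ring
    obtain ⟨Q, hQ, -, hQt⟩ := hS.exists_inner_sq_ne_one hL hP univ_mem
    exact hQt (by rw [hE m hm P hP ht Q hQ ((h Q hQ).trans (h P hP).symm), neg_sq, hm])

end

/-! ### The four configurations of foci -/

section

variable {S : Set Space}

theorem norm_unitDirection {x : Space} (hx : x ≠ 0) : ‖unitDirection x‖ = 1 := by
  rw [unitDirection, norm_smul, norm_inv, norm_norm, inv_mul_cancel₀ (norm_ne_zero_iff.2 hx)]

theorem norm_smul_unitDirection (x : Space) : ‖x‖ • unitDirection x = x := by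
  rcases eq_or_ne x 0 with rfl | hx
  · simp
  · rw [unitDirection, smul_smul, mul_inv_cancel₀ (norm_ne_zero_iff.2 hx), one_smul]

theorem hasUnitGradientOn_norm_sub {F : Space} (hF : F ∉ S) :
    HasUnitGradientOn S (fun P => ‖P - F‖) fun P => unitDirection (P - F) := by
  have h0 : ∀ P ∈ S, P - F ≠ 0 := fun P hP h => hF (sub_eq_zero.1 h ▸ hP)
  refine ⟨fun P hP => ?_, fun P hP => norm_unitDirection (h0 P hP), ?_⟩
  · have h1 := (hasStrictFDerivAt_norm_sq (P - F)).sqrt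
      (pow_ne_zero 2 (norm_ne_zero_iff.2 (h0 P hP)))
    simp only [Real.sqrt_sq (norm_nonneg _)] at h1
    refine (h1.comp P ((hasStrictFDerivAt_id P).sub_const F)).congr_fderiv ?_
    ext x
    simp [unitDirection]
    ring
  · have hc : ContinuousOn (fun P : Space => P - F) S := by fun_prop
    exact (hc.norm.inv₀ fun P hP => norm_ne_zero_iff.2 (h0 P hP)).smul hc

theorem hasUnitGradientOn_inner {e : Space} (he : ‖e‖ = 1) :
    HasUnitGradientOn S (fun P => ⟪e, P⟫) fun _ => e :=
  ⟨fun P _ => (innerSL ℝ e).hasStrictFDerivAt (x := P), fun _ _ => he, continuousOn_const⟩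

theorem Focus.exists_ray_point {F : Space} (hF : F ∉ S) :
    ∀ P ∈ S, ∃ r : ℝ, 0 < r ∧ (Focus.point F).ray P = r • unitDirection (P - F) := fun P hP =>
  ⟨‖P - F‖, norm_pos_iff.2 fun h => hF (sub_eq_zero.1 h ▸ hP), (norm_smul_unitDirection _).symm⟩

theorem Focus.exists_ray_infinity (e : Space) :
    ∀ P ∈ S, ∃ r : ℝ, 0 < r ∧ (Focus.infinity e).ray P = r • e := fun _ _ =>
  ⟨1, one_pos, (one_smul ℝ e).symm⟩

theorem isPerfectLens_point_point_iff (hS : IsSmoothConnectedSurface S) {F F' : Space}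
    (hFF' : F ≠ F') (hF : F ∉ S) (hF' : F' ∉ S) :
    IsPerfectLens S (.point F) (.point F') ↔
      ∃ m c : ℝ, ∀ P ∈ S, ‖P - F‖ + m * ‖P - F'‖ = c := by
  have hφ := hasUnitGradientOn_norm_sub hF
  have hψ := hasUnitGradientOn_norm_sub hF'
  refine isPerfectLens_iff_exists_eq hS hφ hψ
    (Focus.exists_ray_point hF) (Focus.exists_ray_point hF') ⟨F, F' - F, fun Q hQ ht => ?_⟩
    fun m hm P hP ht Q hQ h => ?_
  · have h1 := eq_inner_smul_of_inner_sq_eq_one (hφ.norm_eq_one Q hQ) (hψ.norm_eq_one Q hQ) ht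
    have h2 := norm_smul_unitDirection (Q - F)
    have h3 := norm_smul_unitDirection (Q - F')
    set t := ⟪unitDirection (Q - F), unitDirection (Q - F')⟫
    have h4 : F' - F = (‖Q - F‖ - ‖Q - F'‖ * t) • unitDirection (Q - F) := by
      rw [sub_smul, h2, mul_smul, ← h1, h3]
      abel
    refine ⟨⟨‖Q - F‖ * (‖Q - F‖ - ‖Q - F'‖ * t)⁻¹, ?_⟩, _, h4⟩
    have h5 : ‖Q - F‖ - ‖Q - F'‖ * t ≠ 0 := by
      intro h0
      rw [h0, zero_smul] at h4
      exact hFF' (sub_eq_zero.1 h4).symm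
    rw [h4, mul_smul, smul_smul (_⁻¹), inv_mul_cancel₀ h5, one_smul, h2]
  -- The law of cosines in the triangle `R F F'`, with `m ^ 2 = 1`. On a level set of `φ + m ψ`
  -- where `⟪u, v⟫ + m` vanishes once, the last term must vanish everywhere.
  · have key : ∀ R : Space, (‖R - F‖ + m * ‖R - F'‖) ^ 2 = ‖F' - F‖ ^ 2 +
        2 * ‖R - F‖ * ‖R - F'‖ * (⟪unitDirection (R - F), unitDirection (R - F')⟫ + m) := by
      intro R
      have h2 := norm_sub_sq_real (R - F) (R - F')
      have h3 : R - F - (R - F') = F' - F := by abel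
      have h4 : ⟪R - F, R - F'⟫ =
          ‖R - F‖ * (‖R - F'‖ * ⟪unitDirection (R - F), unitDirection (R - F')⟫) := by
        rw [← inner_smul_right, ← real_inner_smul_left, norm_smul_unitDirection,
          norm_smul_unitDirection]
      rw [h3, h4] at h2
      rw [h2]
      linear_combination ‖R - F'‖ ^ 2 * hm
    have h1 := key Q
    rw [h, key P, ht, neg_add_cancel, mul_zero, add_zero] at h1
    have hQF : ‖Q - F‖ ≠ 0 := norm_ne_zero_iff.2 fun h => hF (sub_eq_zero.1 h ▸ hQ)
    have hQF' : ‖Q - F'‖ ≠ 0 := norm_ne_zero_iff.2 fun h => hF' (sub_eq_zero.1 h ▸ hQ)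
    have h2 := (mul_eq_zero.1 (left_eq_add.1 h1)).resolve_left
      (mul_ne_zero (mul_ne_zero two_ne_zero hQF) hQF')
    linarith

theorem inner_eq_add_norm_mul_inner_unitDirection (e A Q : Space) :
    ⟪e, Q⟫ = ⟪e, A⟫ + ‖Q - A‖ * ⟪e, unitDirection (Q - A)⟫ := by
  rw [← inner_smul_right, norm_smul_unitDirection, inner_sub_right]
  ring

theorem sub_eq_smul_of_inner_sq_eq_one {e A Q : Space} (he : ‖e‖ = 1) (hQ : Q ≠ A)
    (ht : ⟪e, unitDirection (Q - A)⟫ ^ 2 = 1) :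
    Q - A = (‖Q - A‖ * ⟪e, unitDirection (Q - A)⟫) • e := by
  have h1 := eq_inner_smul_of_inner_sq_eq_one he (norm_unitDirection (sub_ne_zero.2 hQ)) ht
  rw [mul_smul, ← h1, norm_smul_unitDirection]

theorem isPerfectLens_infinity_point_iff (hS : IsSmoothConnectedSurface S) {e F' : Space}
    (he : ‖e‖ = 1) (hF' : F' ∉ S) :
    IsPerfectLens S (.infinity e) (.point F') ↔
      ∃ m c : ℝ, ∀ P ∈ S, ⟪e, P⟫ + m * ‖P - F'‖ = c := by
  have hψ := hasUnitGradientOn_norm_sub hF'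
  have hne : ∀ Q ∈ S, Q ≠ F' := fun Q hQ h => hF' (h ▸ hQ)
  refine isPerfectLens_iff_exists_eq hS (hasUnitGradientOn_inner he) hψ
    (Focus.exists_ray_infinity e) (Focus.exists_ray_point hF')
    ⟨F', e, fun Q hQ ht => ⟨⟨_, sub_eq_smul_of_inner_sq_eq_one he (hne Q hQ) ht⟩, 1,
      (one_smul ℝ e).symm⟩⟩ fun m hm P hP ht Q hQ h => ?_
  have h1 := inner_eq_add_norm_mul_inner_unitDirection e F' P
  have h2 := inner_eq_add_norm_mul_inner_unitDirection e F' Q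
  -- Here `φ + m ψ` equals `⟪e, F'⟫ + ‖Q - F'‖ * (⟪u, v⟫ + m)`, so `⟪u, v⟫ + m` vanishes throughout
  -- the level set once it vanishes at `P`.
  have h3 : ‖Q - F'‖ * (⟪e, unitDirection (Q - F')⟫ + m) = 0 := by
    linear_combination h - h2 + h1 + ‖P - F'‖ * ht
  have h4 := (mul_eq_zero.1 h3).resolve_left (norm_ne_zero_iff.2 (sub_ne_zero.2 (hne Q hQ)))
  linarith

theorem isPerfectLens_point_infinity_iff (hS : IsSmoothConnectedSurface S) {F e' : Space}
    (he' : ‖e'‖ = 1) (hF : F ∉ S) :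
    IsPerfectLens S (.point F) (.infinity e') ↔
      ∃ m c : ℝ, ∀ P ∈ S, ‖P - F‖ + m * ⟪e', P⟫ = c := by
  have hφ := hasUnitGradientOn_norm_sub hF
  have hne : ∀ Q ∈ S, Q ≠ F := fun Q hQ h => hF (h ▸ hQ)
  refine isPerfectLens_iff_exists_eq hS hφ (hasUnitGradientOn_inner he')
    (Focus.exists_ray_point hF) (Focus.exists_ray_infinity e')
    ⟨F, e', fun Q hQ ht => ⟨⟨‖Q - F‖ * ⟪e', unitDirection (Q - F)⟫, ?_⟩, _,
      eq_inner_smul_of_inner_sq_eq_one (hφ.norm_eq_one Q hQ) he' ht⟩⟩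
    fun m hm P hP ht Q hQ h => ?_
  · rw [real_inner_comm] at ht
    exact sub_eq_smul_of_inner_sq_eq_one he' (hne Q hQ) ht
  have h1 := inner_eq_add_norm_mul_inner_unitDirection e' F P
  have h2 := inner_eq_add_norm_mul_inner_unitDirection e' F Q
  rw [real_inner_comm] at ht ⊢
  have h3 : ‖Q - F‖ * (⟪e', unitDirection (Q - F)⟫ + m) = 0 := by
    linear_combination m * h - h2 + ‖P - F‖ * ht + h1 + (⟪e', P⟫ - ⟪e', Q⟫) * hm
  have h4 := (mul_eq_zero.1 h3).resolve_left (norm_ne_zero_iff.2 (sub_ne_zero.2 (hne Q hQ)))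
  linarith

theorem exists_norm_eq_one_inner_eq_zero (e : Space) : ∃ w : Space, ‖w‖ = 1 ∧ ⟪e, w⟫ = 0 := by
  obtain ⟨w, hw, hw0⟩ : ∃ w ∈ (Submodule.span ℝ {e})ᗮ, w ≠ 0 := by
    refine Submodule.exists_mem_ne_zero_of_ne_bot fun hbot => ?_
    rw [Submodule.orthogonal_eq_bot_iff] at hbot
    have h1 := finrank_span_le_card (R := ℝ) ({e} : Set Space)
    rw [hbot, finrank_top, finrank_euclideanSpace_fin] at h1
    simp at h1
  refine ⟨unitDirection w, norm_unitDirection hw0, ?_⟩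
  rw [unitDirection, inner_smul_right, Submodule.mem_orthogonal_singleton_iff_inner_right.1 hw,
    mul_zero]

theorem isPerfectLens_infinity_infinity_iff (hS : IsSmoothConnectedSurface S) {e e' : Space}
    (he : ‖e‖ = 1) (he' : ‖e'‖ = 1) :
    IsPerfectLens S (.infinity e) (.infinity e') ↔
      ∃ m c : ℝ, e + m • e' ≠ 0 ∧ ∀ P ∈ S, ⟪e, P⟫ + m * ⟪e', P⟫ = c := by
  have hφ := hasUnitGradientOn_inner (S := S) he
  constructor
  · intro h
    obtain ⟨n, hn⟩ := h.exists_isRefracting hφ.norm_eq_one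
      (hasUnitGradientOn_inner he').norm_eq_one (Focus.exists_ray_infinity e)
      (Focus.exists_ray_infinity e')
    by_cases ht : ⟪e, e'⟫ ^ 2 = 1
    -- For parallel directions every point is exceptional, but `e` itself is normal everywhere.
    -- Replacing `e'` by some `w ⟂ e` and taking `n = 0` makes the general argument apply and yields
    -- `⟪e, P⟫` constant.
    · obtain ⟨w, hw, hew⟩ := exists_norm_eq_one_inner_eq_zero e
      have hn0 : IsRefracting S (fun _ => e) (fun _ => w) 0 := fun P hP N hN =>
        ⟨fun _ => (hn P hP N hN).1 ht, fun _ => Or.inl (by simpa using (hn P hP N hN).1 ht)⟩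
      obtain ⟨m, c, hm, hc⟩ := hn0.exists_eq hS hφ (hasUnitGradientOn_inner hw)
        ⟨0, 0, fun Q _ h => by simp [hew] at h⟩
      have hm0 : m = 0 := by simpa using hm
      refine ⟨0, c, ?_, fun P hP => by simpa [hm0] using hc P hP⟩
      rw [zero_smul, add_zero, ← norm_ne_zero_iff, he]
      exact one_ne_zero
    · obtain ⟨m, c, -, hc⟩ := hn.exists_eq hS hφ (hasUnitGradientOn_inner he')
        ⟨0, 0, fun Q _ h => absurd h ht⟩
      refine ⟨m, c, fun h0 => ?_, hc⟩
      have := eq_zero_of_smul_add_smul_eq_zero he he' ht (a := 1) (b := m) (by rwa [one_smul])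
      exact one_ne_zero this.1
  · rintro ⟨m, c, h0, hc⟩
    exact isPerfectLens_of_eq hφ (hasUnitGradientOn_inner he') (Focus.exists_ray_infinity e)
      (Focus.exists_ray_infinity e') hc fun _ _ => h0

/-! ### Equations of the surfaces of revolution -/

/-- Cylindrical coordinates about the axis. The symmetry `hC` is needed because the distance to the
axis is nonnegative, while points of `C` may have `y < 0`. -/
theorem mem_revolve_iff {A e P : Space} (he : ‖e‖ = 1) {C : Set (ℝ × ℝ)}
    (hC : ∀ x y, (x, y) ∈ C → (x, -y) ∈ C) :
    P ∈ revolve A e C ↔ (⟪e, P - A⟫, ‖P - A - ⟪e, P - A⟫ • e‖) ∈ C := by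
  constructor
  · rintro ⟨⟨x, y⟩, hp, w, hw, hew, rfl⟩
    have h1 : A + x • e + y • w - A = x • e + y • w := by abel
    have h2 : ⟪e, x • e + y • w⟫ = x := by
      rw [inner_add_right, inner_smul_right, inner_smul_right, hew, real_inner_self_eq_norm_sq, he]
      ring
    simp only [h1, h2, add_sub_cancel_left, norm_smul, hw, mul_one, Real.norm_eq_abs]
    rcases abs_choice y with h | h <;> rw [h]
    · exact hp
    · exact hC x y hp
  · intro h
    set x := ⟪e, P - A⟫
    set z := P - A - x • e with hz
    have hez : ⟪e, z⟫ = 0 := by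
      rw [hz, inner_sub_right, inner_smul_right, real_inner_self_eq_norm_sq, he]
      simp [x]
    obtain ⟨w, hw, hew, hzw⟩ : ∃ w : Space, ‖w‖ = 1 ∧ ⟪e, w⟫ = 0 ∧ ‖z‖ • w = z := by
      by_cases hz0 : z = 0
      · obtain ⟨w, hw, hew⟩ := exists_norm_eq_one_inner_eq_zero e
        exact ⟨w, hw, hew, by simp [hz0]⟩
      · refine ⟨unitDirection z, norm_unitDirection hz0, ?_, norm_smul_unitDirection z⟩
        rw [unitDirection, inner_smul_right, hez, mul_zero]
    refine ⟨_, h, w, hw, hew, ?_⟩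
    change P = A + x • e + ‖z‖ • w
    rw [hzw, hz]
    abel

theorem inner_sub_sq_add_norm_sq {e : Space} (he : ‖e‖ = 1) (z : Space) (b : ℝ) :
    (⟪e, z⟫ - b) ^ 2 + ‖z - ⟪e, z⟫ • e‖ ^ 2 = ‖z - b • e‖ ^ 2 := by
  rw [norm_sub_sq_real, norm_sub_sq_real, norm_smul, norm_smul, he, inner_smul_right,
    inner_smul_right, real_inner_comm, mul_one, mul_one, Real.norm_eq_abs, Real.norm_eq_abs,
    sq_abs, sq_abs]
  ring

theorem sqrt_inner_sq_add_norm_sq {e : Space} (he : ‖e‖ = 1) (z : Space) :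
    √(⟪e, z⟫ ^ 2 + ‖z - ⟪e, z⟫ • e‖ ^ 2) = ‖z‖ := by
  have h := inner_sub_sq_add_norm_sq he z 0
  rw [sub_zero, zero_smul, sub_zero] at h
  rw [h, Real.sqrt_sq (norm_nonneg z)]

theorem mem_revolve_cartesianOval_iff {F F' P : Space} (h : F ≠ F') {n c : ℝ} :
    P ∈ revolve F (unitDirection (F' - F)) (cartesianOval (dist F F') n c) ↔
      ‖P - F‖ + n * ‖P - F'‖ = c := by
  have he := norm_unitDirection (sub_ne_zero.2 h.symm)
  rw [mem_revolve_iff he fun x y hxy => by simpa [cartesianOval] using hxy]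
  simp only [cartesianOval, mem_ofPred_eq]
  rw [sqrt_inner_sq_add_norm_sq he, inner_sub_sq_add_norm_sq he, Real.sqrt_sq (norm_nonneg _),
    dist_eq_norm', norm_smul_unitDirection, sub_sub_sub_cancel_right]

theorem mem_revolve_ovalFirstAtInfinity_iff {A e P : Space} (he : ‖e‖ = 1) {n c : ℝ} :
    P ∈ revolve A e (ovalFirstAtInfinity n c) ↔ ⟪e, P⟫ + n * ‖P - A‖ = c + ⟪e, A⟫ := by
  rw [mem_revolve_iff he fun x y hxy => by simpa [ovalFirstAtInfinity] using hxy]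
  simp only [ovalFirstAtInfinity, mem_ofPred_eq]
  rw [sqrt_inner_sq_add_norm_sq he, inner_sub_right]
  constructor <;> intro h <;> linarith

theorem mem_revolve_ovalSecondAtInfinity_iff {A e P : Space} (he : ‖e‖ = 1) {n c : ℝ} :
    P ∈ revolve A e (ovalSecondAtInfinity n c) ↔ ‖P - A‖ + n * ⟪e, P⟫ = c + n * ⟪e, A⟫ := by
  rw [mem_revolve_iff he fun x y hxy => by simpa [ovalSecondAtInfinity] using hxy]
  simp only [ovalSecondAtInfinity, mem_ofPred_eq]
  rw [sqrt_inner_sq_add_norm_sq he, inner_sub_right]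
  constructor <;> intro h <;> linarith

theorem mem_revolve_line_iff {x P : Space} (hx : x ≠ 0) {c : ℝ} :
    P ∈ revolve 0 (unitDirection x) {p : ℝ × ℝ | p.1 = c} ↔ ⟪x, P⟫ = ‖x‖ * c := by
  rw [mem_revolve_iff (norm_unitDirection hx) fun x y hxy => by simpa using hxy]
  simp only [mem_ofPred_eq, sub_zero]
  nth_rw 2 [← norm_smul_unitDirection x]
  rw [real_inner_smul_left, mul_right_inj' (norm_ne_zero_iff.2 hx)]

end

theorem mainTheorem1 (S : Set Space) (hS : IsSmoothConnectedSurface S) :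
    -- two distinct finite foci
    (∀ F F' : Space, F ≠ F' → F ∉ S → F' ∉ S →
      (IsPerfectLens S (.point F) (.point F') ↔
        ∃ n c : ℝ, S ⊆ revolve F (unitDirection (F' - F)) (cartesianOval (dist F F') n c))) ∧
    -- the first focus at infinity
    (∀ e F' : Space, ‖e‖ = 1 → F' ∉ S →
      (IsPerfectLens S (.infinity e) (.point F') ↔
        ∃ n c : ℝ, S ⊆ revolve F' e (ovalFirstAtInfinity n c))) ∧
    -- the second focus at infinity
    (∀ F e' : Space, ‖e'‖ = 1 → F ∉ S →
      (IsPerfectLens S (.point F) (.infinity e') ↔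
        ∃ n c : ℝ, S ⊆ revolve F e' (ovalSecondAtInfinity n c))) ∧
    -- both foci at infinity: the straight line `x = c`, revolved into a plane
    (∀ e e' : Space, ‖e‖ = 1 → ‖e'‖ = 1 →
      (IsPerfectLens S (.infinity e) (.infinity e') ↔
        ∃ n c : ℝ, e + n • e' ≠ 0 ∧
          S ⊆ revolve 0 (unitDirection (e + n • e')) {p : ℝ × ℝ | p.1 = c})) := by

  refine ⟨fun F F' hFF' hF hF' => ?_, fun e F' he hF' => ?_, fun F e' he' hF => ?_,
    fun e e' he he' => ?_⟩
  · rw [isPerfectLens_point_point_iff hS hFF' hF hF']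
    simp only [Set.subset_def, mem_revolve_cartesianOval_iff hFF']
  · rw [isPerfectLens_infinity_point_iff hS he hF']
    simp only [Set.subset_def, mem_revolve_ovalFirstAtInfinity_iff he]
    -- Placing the origin at `F'` shifts the constant by `⟪e, F'⟫`.
    exact exists_congr fun n => ((Equiv.subRight ⟪e, F'⟫).exists_congr_left).trans (by simp)
  · rw [isPerfectLens_point_infinity_iff hS he' hF]
    simp only [Set.subset_def, mem_revolve_ovalSecondAtInfinity_iff he']
    exact exists_congr fun n => ((Equiv.subRight (n * ⟪e', F⟫)).exists_congr_left).trans (by simp)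
  · rw [isPerfectLens_infinity_infinity_iff hS he he']
    refine exists_congr fun n => ?_
    constructor
    · rintro ⟨c, h0, h⟩
      refine ⟨‖e + n • e'‖⁻¹ * c, h0, fun P hP => ?_⟩
      rw [mem_revolve_line_iff h0, inner_add_left, real_inner_smul_left, h P hP, ← mul_assoc,
        mul_inv_cancel₀ (norm_ne_zero_iff.2 h0), one_mul]
    · rintro ⟨c, h0, h⟩
      refine ⟨‖e + n • e'‖ * c, h0, fun P hP => ?_⟩
      rw [← (mem_revolve_line_iff h0).1 (h hP), inner_add_left, real_inner_smul_left]
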